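/- Let $k$ be a field, let $n>0$, $d>0$ and $q\ge 0$ be integers with $d\le (n+1)(q-1)$, let $S=k[x_0,\dots,x_n]$ with its standard grading, and let $f\in S$ be a homogeneous polynomial of degree $d$ (the zero polynomial being allowed). Put $x^{[q]}=(x_0^q,\dots,x_n^q)$ and consider the graded $S$-modules of finite length $$\Theta=S/x^{[q]},\qquad \theta=S/\big((f)+x^{[q]}\big),\qquad \vartheta=(x^{[q]}:f)/x^{[q]}\subseteq\Theta .$$ Let $a(q)=\max\{i:\theta_i\ne 0\}$ (the socle degree of $\theta$), $\imath(q)=\min\{i:\vartheta_i\neq 0\}$ (the initial degree of $\vartheta$), $HK_{R,x}(q)=\dim_k\theta$ (where $R=S/(f)$), and $$m(q)=\left\lfloor\frac{(n+1)(q-1)+(d-1)}{2}\right\rfloor,\qquad L(q)=\sum_{i\in\mathbb Z}\max\{\dim_k\Theta_i-\dim_k\Theta_{i-d},\,0\}.$$ The maximum and the minimum exist, and $$a(q)\ge m(q),\qquad \imath(q)\le (n+1)(q-1)-m(q),\qquad HK_{R,x}(q)\ge L(q).$$ Moreover, the following statements are equivalent: (i) $f$ is of maximal rank at $q$, that is,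 for every $i\in\mathbb Z$ the $k$-linear map $\Theta_{i-d}\to\Theta_i$ given by multiplication by $f$ has rank $\min\{\dim_k\Theta_{i-d},\dim_k\Theta_i\}$; (ii) the socle degree is minimal: $a(q)=m(q)$; (iii) the initial degree is maximal: $\imath(q)=(n+1)(q-1)-m(q)$; (iv) the generalized Hilbert-Kunz function attains the lower bound: $HK_{R,x}(q)=L(q)$. -/

import Mathlib

open MvPolynomial

noncomputable section

namespace HilbertKunz

/-- The polynomial ring `S = k[x_0, …, x_n]`. -/
abbrev Poly (k : Type*) [Field k] (n : ℕ) : Type _ := MvPolynomial (Fin (n + 1)) k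

/-- The homogeneous component `S_i` of `S`, for an integer `i`; it is zero for `i < 0`. -/
def polyPiece (k : Type*) [Field k] (n : ℕ) : ℤ → Submodule k (Poly k n)
  | Int.ofNat j => homogeneousSubmodule (Fin (n + 1)) k j
  | Int.negSucc _ => ⊥

/-- The degree `i` component of the graded ring `S / J` (for a homogeneous ideal `J`): the image
of `S_i`. -/
def quotPiece {k : Type*} [Field k] {n : ℕ} (J : Ideal (Poly k n)) (i : ℤ) :
    Submodule k (Poly k n ⧸ J) :=
  (polyPiece k n i).map (Ideal.Quotient.mkₐ k J).toLinearMap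

/-- The ideal `x^[q] = (x_0 ^ q, …, x_n ^ q)`. -/
def powIdeal (k : Type*) [Field k] (n q : ℕ) : Ideal (Poly k n) :=
  Ideal.span (Set.range fun j : Fin (n + 1) => (X j : Poly k n) ^ q)

/-- The ideal `(f) + x^[q]`. -/
def formIdeal {k : Type*} [Field k] {n : ℕ} (f : Poly k n) (q : ℕ) : Ideal (Poly k n) :=
  Ideal.span {f} ⊔ powIdeal k n q

/-- The ring `Θ = S / x^[q]`. -/
abbrev BigTheta (k : Type*) [Field k] (n q : ℕ) : Type _ := Poly k n ⧸ powIdeal k n q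

/-- The ring `θ = S / (f + x^[q])`. -/
abbrev SmallTheta {k : Type*} [Field k] {n : ℕ} (f : Poly k n) (q : ℕ) : Type _ :=
  Poly k n ⧸ formIdeal f q

/-- The component `Θ_i`. -/
def bigThetaPiece (k : Type*) [Field k] (n q : ℕ) (i : ℤ) : Submodule k (BigTheta k n q) :=
  quotPiece (powIdeal k n q) i

/-- The component `θ_i`. -/
def smallThetaPiece {k : Type*} [Field k] {n : ℕ} (f : Poly k n) (q : ℕ) (i : ℤ) :
    Submodule k (SmallTheta f q) :=
  quotPiece (formIdeal f q) i

/-- The ideal `ϑ = (x^[q] : f) / x^[q]` of `Θ`. -/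
def varTheta {k : Type*} [Field k] {n : ℕ} (f : Poly k n) (q : ℕ) : Ideal (BigTheta k n q) :=
  ((powIdeal k n q).colon {f}).map (Ideal.Quotient.mk (powIdeal k n q))

/-- The component `ϑ_i = ϑ ∩ Θ_i`. -/
def varThetaPiece {k : Type*} [Field k] {n : ℕ} (f : Poly k n) (q : ℕ) (i : ℤ) :
    Submodule k (BigTheta k n q) :=
  (varTheta f q).restrictScalars k ⊓ bigThetaPiece k n q i

/-- The set of degrees `i` with `θ_i ≠ 0`. -/
def smallThetaDegrees {k : Type*} [Field k] {n : ℕ} (f : Poly k n) (q : ℕ) : Set ℤ :=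
  {i | smallThetaPiece f q i ≠ ⊥}

/-- The set of degrees `i` with `ϑ_i ≠ 0`. -/
def varThetaDegrees {k : Type*} [Field k] {n : ℕ} (f : Poly k n) (q : ℕ) : Set ℤ :=
  {i | varThetaPiece f q i ≠ ⊥}

/-- The socle degree `a(q) = max {i | θ_i ≠ 0}`. -/
def socleDegree {k : Type*} [Field k] {n : ℕ} (f : Poly k n) (q : ℕ) : ℤ :=
  sSup (smallThetaDegrees f q)

/-- The initial degree `min {i | ϑ_i ≠ 0}`. -/
def initialDegree {k : Type*} [Field k] {n : ℕ} (f : Poly k n) (q : ℕ) : ℤ :=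
  sInf (varThetaDegrees f q)

/-- The generalized Hilbert-Kunz function `dim_k S / (f, x_0 ^ q, …, x_n ^ q)`. -/
def hilbertKunz {k : Type*} [Field k] {n : ℕ} (f : Poly k n) (q : ℕ) : ℕ :=
  Module.finrank k (SmallTheta f q)

/-- The restriction `f|Θ_j` of the multiplication by `f` on `Θ`. -/
def mulRestrict {k : Type*} [Field k] {n : ℕ} (f : Poly k n) (q : ℕ) (j : ℤ) :
    bigThetaPiece k n q j →ₗ[k] BigTheta k n q :=
  (LinearMap.mulLeft k (Ideal.Quotient.mk (powIdeal k n q) f)).domRestrict (bigThetaPiece k n q j)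

/-- `f`, a form of degree `d`, is of maximal rank at `q`: in each degree `i`, the map
`f : Θ_{i-d} → Θ_i` has rank `min (dim Θ_{i-d}) (dim Θ_i)`. -/
def IsMaximalRank {k : Type*} [Field k] {n : ℕ} (f : Poly k n) (d q : ℕ) : Prop :=
  ∀ i : ℤ, Module.finrank k (LinearMap.range (mulRestrict f q (i - d))) =
    min (Module.finrank k (bigThetaPiece k n q (i - d)))
      (Module.finrank k (bigThetaPiece k n q i))

/-- `L(q) = ∑_i max (dim Θ_i - dim Θ_{i-d}, 0)`; only finitely many `Θ_i` are nonzero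
when `q > 0`. -/
def lowerBound (k : Type*) [Field k] (n d q : ℕ) : ℤ :=
  ∑ᶠ i : ℤ, max ((Module.finrank k (bigThetaPiece k n q i) : ℤ) -
    (Module.finrank k (bigThetaPiece k n q (i - d)) : ℤ)) 0

/-- `m(q) = ⌊((n + 1)(q - 1) + (d - 1)) / 2⌋`; division of integers by `2` rounds down. -/
def midDegree (n d q : ℕ) : ℤ :=
  (((n : ℤ) + 1) * ((q : ℤ) - 1) + ((d : ℤ) - 1)) / 2

end HilbertKunz

end

noncomputable section

namespace HilbertKunz

/-! Write N = (n+1)(q-1). The monomials with all exponents below q form a basis of Θ, so dim Θ_i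
counts the points of a box with coordinate sum i. This function is symmetric about N/2 and, since
there are at least two variables, strictly increasing up to the middle. Hence dim Θ_{i-d} < dim Θ_i
for 0 ≤ i ≤ min(m(q), N), and dim Θ_{i-d} ≥ dim Θ_i for i > m(q).

As θ is the cokernel of multiplication by f, dim θ_i = dim Θ_i - rank(f : Θ_{i-d} → Θ_i). Bounding
the rank by dim Θ_{i-d} gives θ_{m(q)} ≠ 0 and, summed over i, HK ≥ L, with equality iff every rank
is maximal.

Multiplication into Θ_N = k is a perfect pairing, so ϑ_j = 0 iff θ_{N-j} = 0. Thus the initial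
degree is N - a(q), and the statements on it are those on a(q). If a(q) = m(q), then f is surjective
onto every degree above m(q), and by duality injective into every degree at most m(q): maximal rank
everywhere. -/

/-! ### Box counts: symmetry and strict unimodality. -/

/-- The number of vectors in `{0, …, q - 1} ^ r` whose entries have sum `i`. -/
def boxCount (q r : ℕ) (i : ℤ) : ℕ :=
  (Finset.univ.filter fun v : Fin r → Fin q => ∑ j, ((v j : ℕ) : ℤ) = i).card

theorem boxCount_succ (q r : ℕ) (i : ℤ) :
    boxCount q (r + 1) i = ∑ j ∈ Finset.range q, boxCount q r (i - j) := by
  simp only [boxCount, Finset.card_filter]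
  rw [← (Fin.consEquiv fun _ : Fin (r + 1) => Fin q).sum_comp, Fintype.sum_prod_type,
    Finset.sum_range]
  refine Finset.sum_congr rfl fun a _ => Finset.sum_congr rfl fun v _ => ?_
  simp only [Fin.consEquiv_apply, Fin.sum_univ_succ, Fin.cons_zero, Fin.cons_succ]
  congr 1
  exact propext ⟨fun h => by linarith, fun h => by linarith⟩

/-- The involution v_j ↦ q - 1 - v_j of the box exchanges the two slices. -/
theorem boxCount_symm (q r : ℕ) (i : ℤ) :
    boxCount q r (r * ((q : ℤ) - 1) - i) = boxCount q r i := by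
  unfold boxCount
  refine Finset.card_bij' (fun v _ => fun j => (v j).rev) (fun v _ => fun j => (v j).rev)
    ?_ ?_ (by simp) (by simp)
  all_goals
    intro v hv
    have key : ∑ j, (((v j).rev : ℕ) : ℤ) = r * ((q : ℤ) - 1) - ∑ j, ((v j : ℕ) : ℤ) := by
      have h : ∀ j, (((v j).rev : ℕ) : ℤ) = ((q : ℤ) - 1) - ((v j : ℕ) : ℤ) := fun j => by
        have := (v j).isLt
        rw [Fin.val_rev]
        omega
      rw [Finset.sum_congr rfl fun j _ => h j, Finset.sum_sub_distrib]
      simp [mul_sub]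
    simp only [Finset.mem_filter, Finset.mem_univ, true_and] at hv ⊢
    rw [key, hv]
    try ring

theorem boxCount_of_neg (q r : ℕ) {i : ℤ} (hi : i < 0) : boxCount q r i = 0 := by
  unfold boxCount
  rw [Finset.card_eq_zero, Finset.filter_eq_empty_iff]
  intro v _ h
  have : 0 ≤ ∑ j, ((v j : ℕ) : ℤ) := Finset.sum_nonneg fun j _ => by positivity
  omega

theorem boxCount_of_gt (q r : ℕ) {i : ℤ} (hi : r * ((q : ℤ) - 1) < i) : boxCount q r i = 0 := by
  rw [← boxCount_symm]
  exact boxCount_of_neg q r (by linarith)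

/-- Two adjacent windows of length q differ only at their ends; equivalently, (1 - t)(1 + ⋯ +
t^(q-1)) = 1 - t^q for generating functions. -/
theorem boxCount_succ_sub (q r : ℕ) (i : ℤ) :
    (boxCount q (r + 1) i : ℤ) - boxCount q (r + 1) (i - 1) =
      boxCount q r i - boxCount q r (i - q) := by
  rw [boxCount_succ, boxCount_succ]
  push_cast
  have h := Finset.sum_range_sub' (fun j : ℕ => (boxCount q r (i - j) : ℤ)) q
  rw [Finset.sum_sub_distrib] at h
  have e : ∀ j : ℕ, i - 1 - (j : ℤ) = i - ((j + 1 : ℕ) : ℤ) := fun j => by push_cast; ring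
  simp only [e]
  simpa using h

theorem boxCount_one (q : ℕ) {i : ℤ} (h0 : 0 ≤ i) (hi : i < q) : boxCount q 1 i = 1 := by
  lift i to ℕ using h0
  rw [boxCount, Finset.card_eq_one]
  refine ⟨fun _ => ⟨i, by omega⟩, ?_⟩
  ext v
  simp only [Finset.univ_unique, Finset.sum_singleton, Finset.mem_filter, Finset.mem_univ,
    true_and, Finset.mem_singleton]
  constructor
  · intro h
    ext j
    rw [Subsingleton.elim j default]
    exact_mod_cast h
  · rintro rfl
    rfl

/-- If the increments of a function symmetric about `N / 2` are positive up to the middle, then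
the function is larger at points of `[0, N]` that are closer to the middle. -/
theorem lt_of_symm_of_increments {N : ℤ} {c : ℤ → ℕ} (hneg : ∀ i < 0, c i = 0)
    (hsymm : ∀ i, c (N - i) = c i) (hinc : ∀ i, 0 ≤ i → 2 * i ≤ N → c (i - 1) < c i)
    {a b : ℤ} (hab : a < b) (hb : 0 ≤ b) (hbN : b ≤ N) (hsum : a + b < N) : c a < c b := by
  have left : ∀ t : ℕ, ∀ a : ℤ, 2 * (t : ℤ) ≤ N → a < t → c a < c t := by
    intro t
    induction t with
    | zero =>
      intro a ht ha
      have := hinc 0 le_rfl (by simpa using ht)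
      rw [hneg a (by simpa using ha)]
      exact (Nat.zero_le _).trans_lt this
    | succ t ih =>
      intro a ht ha
      have h := hinc ((t + 1 : ℕ) : ℤ) (by positivity) ht
      push_cast at h ht ha ⊢
      rw [add_sub_cancel_right] at h
      rcases (Int.lt_add_one_iff.mp ha).lt_or_eq with h' | rfl
      · exact (ih a (by linarith) h').trans h
      · exact h
  by_cases h : 2 * b ≤ N
  · lift b to ℕ using hb
    exact left b a h hab
  -- Past the middle, reflect: N - b is in the left half, and a < N - b is the hypothesis on a + b.
  · rw [← hsymm b]
    obtain ⟨t, ht⟩ := Int.eq_ofNat_of_zero_le (sub_nonneg.mpr hbN)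
    rw [ht]
    exact left t a (by omega) (by omega)

/-- By `boxCount_succ_sub`, an increment for one more variable compares the previous counts at i - q
and i, and i is closer to the middle. Strictness needs two variables: for one, the count is constant
on [0, q - 1]. -/
theorem boxCount_sub_one_lt {q : ℕ} (hq : 0 < q) (r : ℕ) {i : ℤ} (h0 : 0 ≤ i)
    (hi : 2 * i ≤ ((r + 2 : ℕ) : ℤ) * ((q : ℤ) - 1)) :
    boxCount q (r + 2) (i - 1) < boxCount q (r + 2) i := by
  induction r generalizing i with
  | zero =>
    have h := boxCount_succ_sub q 1 i
    push_cast at hi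
    rw [boxCount_one q h0 (by linarith), boxCount_of_neg q 1 (i := i - q) (by linarith)] at h
    simp only [zero_add, Nat.reduceAdd] at h ⊢
    omega
  | succ r ih =>
    have h := boxCount_succ_sub q (r + 2) i
    have hr : 0 ≤ (r : ℤ) * ((q : ℤ) - 1) := mul_nonneg (by positivity) (by omega)
    have key : boxCount q (r + 2) (i - q) < boxCount q (r + 2) i := by
      push_cast at hi
      refine lt_of_symm_of_increments (N := ((r + 2 : ℕ) : ℤ) * ((q : ℤ) - 1))
        (fun i hi => boxCount_of_neg q _ hi) (boxCount_symm q _) (fun i h h' => ih h h')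
        (by omega) h0 ?_ ?_
      · push_cast
        nlinarith
      -- The sum 2i - q is below the bound because q exceeds the q - 1 gained by adding a variable.
      · push_cast
        linarith
    have e : r + 1 + 2 = r + 2 + 1 := rfl
    rw [e]
    omega

theorem boxCount_lt {q r : ℕ} (hq : 0 < q) (hr : 2 ≤ r) {a b : ℤ} (hab : a < b) (hb : 0 ≤ b)
    (hbN : b ≤ r * ((q : ℤ) - 1)) (hsum : a + b < r * ((q : ℤ) - 1)) :
    boxCount q r a < boxCount q r b := by
  obtain ⟨r, rfl⟩ := Nat.exists_eq_add_of_le' hr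
  exact lt_of_symm_of_increments (fun i hi => boxCount_of_neg q _ hi) (boxCount_symm q _)
    (fun i h h' => boxCount_sub_one_lt hq r h h') hab hb hbN hsum

theorem boxCount_le {q r : ℕ} (hq : 0 < q) (hr : 2 ≤ r) {a b : ℤ} (hab : a ≤ b)
    (hsum : a + b ≤ r * ((q : ℤ) - 1)) : boxCount q r a ≤ boxCount q r b := by
  rcases lt_or_ge a 0 with ha | ha
  · simp [boxCount_of_neg q r ha]
  rcases hsum.lt_or_eq with h | h
  · rcases hab.lt_or_eq with h' | rfl
    · exact (boxCount_lt hq hr h' (by omega) (by omega) h).le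
    · exact le_rfl
  · rw [← boxCount_symm q r b, show (r : ℤ) * ((q : ℤ) - 1) - b = a by omega]

/-! ### The monomial basis of Θ and its grading. -/

variable {k : Type*} [Field k] {n q : ℕ}

/-- The exponent of a monomial all of whose partial degrees are less than `q`. -/
def boxExponent (b : Fin (n + 1) → Fin q) : Fin (n + 1) →₀ ℕ :=
  Finsupp.equivFunOnFinite.symm fun j => (b j : ℕ)

@[simp]
theorem boxExponent_apply (b : Fin (n + 1) → Fin q) (j : Fin (n + 1)) :
    boxExponent b j = b j := rfl

theorem boxExponent_injective :
    Function.Injective (boxExponent : (Fin (n + 1) → Fin q) → Fin (n + 1) →₀ ℕ) := by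
  intro b c h
  ext j
  simpa using DFunLike.congr_fun h j

theorem degree_boxExponent (b : Fin (n + 1) → Fin q) :
    (boxExponent b).degree = ∑ j, (b j : ℕ) := by
  rw [Finsupp.degree_eq_sum]
  rfl

variable (k n q) in
/-- The coefficients of a polynomial at the monomials outside `x^[q]`. -/
def boxCoeff : Poly k n →ₗ[k] ((Fin (n + 1) → Fin q) → k) :=
  LinearMap.pi fun b => MvPolynomial.lcoeff k (boxExponent b)

theorem boxCoeff_apply (g : Poly k n) (b : Fin (n + 1) → Fin q) :
    boxCoeff k n q g b = coeff (boxExponent b) g := rfl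

theorem mem_powIdeal_iff (g : Poly k n) :
    g ∈ powIdeal k n q ↔ ∀ e ∈ g.support, ∃ j, q ≤ e j := by
  have h : powIdeal k n q = Ideal.span ((fun s => monomial s (1 : k)) ''
      Set.range fun j : Fin (n + 1) => Finsupp.single j q) := by
    rw [powIdeal, ← Set.range_comp]
    simp only [Function.comp_def, X_pow_eq_monomial]
  rw [h, mem_ideal_span_monomial_image]
  simp

theorem ker_boxCoeff : LinearMap.ker (boxCoeff k n q) = (powIdeal k n q).restrictScalars k := by
  ext g
  rw [LinearMap.mem_ker, Submodule.restrictScalars_mem, mem_powIdeal_iff]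
  constructor
  · intro h e he
    by_contra! hlt
    refine mem_support_iff.mp he ?_
    have h' := congr_fun h fun j => (⟨e j, hlt j⟩ : Fin q)
    rwa [boxCoeff_apply, show boxExponent (fun j => (⟨e j, hlt j⟩ : Fin q)) = e by ext; rfl] at h'
  · intro h
    ext b
    rw [boxCoeff_apply]
    by_contra hb
    obtain ⟨j, hj⟩ := h _ (mem_support_iff.mpr hb)
    exact absurd (b j).isLt (not_lt.mpr hj)

theorem boxCoeff_monomial (b c : Fin (n + 1) → Fin q) (a : k) :
    boxCoeff k n q (monomial (boxExponent b) a) c = if b = c then a else 0 := by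
  rw [boxCoeff_apply, coeff_monomial]
  simp only [boxExponent_injective.eq_iff]

theorem boxCoeff_sum_monomial (v : (Fin (n + 1) → Fin q) → k) :
    boxCoeff k n q (∑ b, monomial (boxExponent b) (v b)) = v := by
  ext c
  rw [map_sum, Finset.sum_apply]
  simp [boxCoeff_monomial]

theorem boxCoeff_surjective : Function.Surjective (boxCoeff k n q) := fun v =>
  ⟨_, boxCoeff_sum_monomial v⟩

variable (k n q) in
/-- The monomials outside `x^[q]` give coordinates on `Θ`. -/
def bigThetaEquiv : BigTheta k n q ≃ₗ[k] ((Fin (n + 1) → Fin q) → k) :=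
  (Submodule.Quotient.restrictScalarsEquiv k (powIdeal k n q)).symm.trans
    ((Submodule.quotEquivOfEq _ _ ker_boxCoeff.symm).trans
      ((boxCoeff k n q).quotKerEquivOfSurjective boxCoeff_surjective))

@[simp]
theorem bigThetaEquiv_mk (g : Poly k n) :
    bigThetaEquiv k n q (Ideal.Quotient.mk (powIdeal k n q) g) = boxCoeff k n q g := rfl

instance : Module.Finite k (BigTheta k n q) := Module.Finite.equiv (bigThetaEquiv k n q).symm

theorem mem_polyPiece_natCast {i : ℕ} {g : Poly k n} :
    g ∈ polyPiece k n i ↔ g.IsHomogeneous i := Iff.rfl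

theorem polyPiece_of_neg {i : ℤ} (hi : i < 0) : polyPiece k n i = ⊥ := by
  obtain ⟨j, rfl⟩ := Int.eq_negSucc_of_lt_zero hi
  rfl

theorem mem_polyPiece_iff {i : ℤ} {g : Poly k n} :
    g ∈ polyPiece k n i ↔ ∀ e, (e.degree : ℤ) ≠ i → coeff e g = 0 := by
  rcases lt_or_ge i 0 with hi | hi
  · rw [polyPiece_of_neg hi, Submodule.mem_bot, MvPolynomial.ext_iff]
    exact forall_congr' fun e => ⟨fun h _ => by simpa using h, fun h => by
      simpa using h (by omega)⟩
  · lift i to ℕ using hi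
    rw [mem_polyPiece_natCast]
    constructor
    · exact fun h e he => h.coeff_eq_zero (by exact_mod_cast he)
    · intro h
      rw [← mem_homogeneousSubmodule, homogeneousSubmodule_eq_finsupp_supported]
      intro e he
      by_contra h'
      exact Finsupp.mem_support_iff.mp he (h e (by exact_mod_cast h'))

theorem mul_mem_polyPiece {i j : ℤ} {g h : Poly k n} (hg : g ∈ polyPiece k n i)
    (hh : h ∈ polyPiece k n j) : g * h ∈ polyPiece k n (i + j) := by
  rcases lt_or_ge i 0 with hi | hi
  · rw [polyPiece_of_neg hi, Submodule.mem_bot] at hg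
    simp [hg]
  rcases lt_or_ge j 0 with hj | hj
  · rw [polyPiece_of_neg hj, Submodule.mem_bot] at hh
    simp [hh]
  lift i to ℕ using hi
  lift j to ℕ using hj
  exact_mod_cast (mem_polyPiece_natCast.mp hg).mul (mem_polyPiece_natCast.mp hh)

theorem mem_quotPiece {J : Ideal (Poly k n)} {i : ℤ} {x : Poly k n ⧸ J} :
    x ∈ quotPiece J i ↔ ∃ g ∈ polyPiece k n i, Ideal.Quotient.mk J g = x := Iff.rfl

theorem mk_mem_quotPiece (J : Ideal (Poly k n)) {i : ℤ} {g : Poly k n}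
    (hg : g ∈ polyPiece k n i) : Ideal.Quotient.mk J g ∈ quotPiece J i :=
  mem_quotPiece.mpr ⟨g, hg, rfl⟩

theorem mul_mem_quotPiece {J : Ideal (Poly k n)} {i j : ℤ} {x y : Poly k n ⧸ J}
    (hx : x ∈ quotPiece J i) (hy : y ∈ quotPiece J j) : x * y ∈ quotPiece J (i + j) := by
  obtain ⟨g, hg, rfl⟩ := mem_quotPiece.mp hx
  obtain ⟨h, hh, rfl⟩ := mem_quotPiece.mp hy
  rw [← map_mul]
  exact mk_mem_quotPiece J (mul_mem_polyPiece hg hh)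

theorem monomial_mem_polyPiece (e : Fin (n + 1) →₀ ℕ) (a : k) :
    monomial e a ∈ polyPiece k n e.degree :=
  isHomogeneous_monomial a rfl

/-- Every class has a normal form supported on box monomials; for the converse this normal form
serves as the homogeneous representative. -/
theorem mem_bigThetaPiece_iff {i : ℤ} {x : BigTheta k n q} :
    x ∈ bigThetaPiece k n q i ↔
      ∀ b, ∑ j, ((b j : ℕ) : ℤ) ≠ i → bigThetaEquiv k n q x b = 0 := by
  have hdeg : ∀ b : Fin (n + 1) → Fin q,
      ((boxExponent b).degree : ℤ) = ∑ j, ((b j : ℕ) : ℤ) := fun b => by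
    rw [degree_boxExponent]
    push_cast
    rfl
  constructor
  · intro hx b hb
    obtain ⟨g, hg, rfl⟩ := mem_quotPiece.mp hx
    rw [bigThetaEquiv_mk, boxCoeff_apply]
    exact mem_polyPiece_iff.mp hg _ (by rwa [hdeg])
  · intro h
    have hx : x = Ideal.Quotient.mk (powIdeal k n q)
        (∑ b, monomial (boxExponent b) (bigThetaEquiv k n q x b)) :=
      (bigThetaEquiv k n q).injective (by rw [bigThetaEquiv_mk, boxCoeff_sum_monomial])
    rw [hx]
    refine mk_mem_quotPiece _ (Submodule.sum_mem _ fun b _ => ?_)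
    by_cases hb : ∑ j, ((b j : ℕ) : ℤ) = i
    · rw [← hb, ← hdeg]
      exact monomial_mem_polyPiece _ _
    · rw [h b hb, monomial_zero]
      exact Submodule.zero_mem _

theorem finrank_bigThetaPiece (i : ℤ) :
    Module.finrank k (bigThetaPiece k n q i) = boxCount q (n + 1) i := by
  let r : bigThetaPiece k n q i →ₗ[k]
      ({b : Fin (n + 1) → Fin q // ∑ j, ((b j : ℕ) : ℤ) = i} → k) :=
    (LinearMap.funLeft k k Subtype.val) ∘ₗ (bigThetaEquiv k n q).toLinearMap ∘ₗ
      (bigThetaPiece k n q i).subtype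
  have hr : Function.Bijective r := by
    constructor
    · rw [← LinearMap.ker_eq_bot, LinearMap.ker_eq_bot']
      intro x hx
      refine Subtype.ext ((bigThetaEquiv k n q).injective ?_)
      ext b
      rw [ZeroMemClass.coe_zero, map_zero]
      by_cases hb : ∑ j, ((b j : ℕ) : ℤ) = i
      · exact congr_fun hx ⟨b, hb⟩
      · exact mem_bigThetaPiece_iff.mp x.2 b hb
    · intro v
      classical
      refine ⟨⟨(bigThetaEquiv k n q).symm fun b => if hb : _ then v ⟨b, hb⟩ else 0,
        mem_bigThetaPiece_iff.mpr fun b hb => ?_⟩, ?_⟩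
      · rw [LinearEquiv.apply_symm_apply, dif_neg hb]
      · ext b
        simp [r, LinearMap.funLeft_apply, b.2]
  rw [(LinearEquiv.ofBijective r hr).finrank_eq, Module.finrank_fintype_fun_eq_card,
    Fintype.card_subtype]
  rfl

/-! ### Gorenstein duality on Θ. -/

/-- The pairing `Θ_i × Θ_{N-i} → Θ_N = k`, where `N = (n + 1)(q - 1)`, is nondegenerate. -/
theorem exists_mul_coeff_ne_zero {i : ℤ} {top : Fin (n + 1) → Fin q}
    (htop : ∀ j, (top j : ℕ) = q - 1) {x : BigTheta k n q} (hx : x ∈ bigThetaPiece k n q i)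
    (hx0 : x ≠ 0) : ∃ y ∈ bigThetaPiece k n q (((n : ℤ) + 1) * ((q : ℤ) - 1) - i),
      bigThetaEquiv k n q (x * y) top ≠ 0 := by
  obtain ⟨b, hb⟩ : ∃ b, bigThetaEquiv k n q x b ≠ 0 := by
    by_contra! h
    exact hx0 ((bigThetaEquiv k n q).injective (by ext b; simp [h b]))
  have hbi : ∑ j, ((b j : ℕ) : ℤ) = i := by
    by_contra h
    exact hb (mem_bigThetaPiece_iff.mp hx b h)
  obtain ⟨g, rfl⟩ := Ideal.Quotient.mk_surjective x
  -- The complementary monomial: multiplying by it moves the coefficient at b to the socle monomial.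
  let c : Fin (n + 1) → Fin q := fun j => (b j).rev
  refine ⟨Ideal.Quotient.mk _ (monomial (boxExponent c) 1), ?_, ?_⟩
  · convert mk_mem_quotPiece (powIdeal k n q) (monomial_mem_polyPiece (boxExponent c) 1)
    have h : ∀ j, ((c j : ℕ) : ℤ) = ((q : ℤ) - 1) - ((b j : ℕ) : ℤ) := fun j => by
      have := (b j).isLt
      simp only [c, Fin.val_rev]
      omega
    rw [bigThetaPiece, degree_boxExponent]
    push_cast
    rw [Finset.sum_congr rfl fun j _ => h j, Finset.sum_sub_distrib, hbi, Finset.sum_const,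
      Finset.card_univ, Fintype.card_fin, nsmul_eq_mul]
    push_cast
    rfl
  · have e : boxExponent top = boxExponent b + boxExponent c := by
      ext j
      have := (b j).isLt
      simp only [boxExponent_apply, Finsupp.add_apply, htop, c, Fin.val_rev]
      omega
    rw [← map_mul, bigThetaEquiv_mk, boxCoeff_apply, e, coeff_mul_monomial, mul_one]
    exact hb

/-- Every linear form on `Θ_{N-i}` is represented by an element of `Θ_i`. -/
theorem exists_forall_coeff_mul_eq {i : ℤ} {top : Fin (n + 1) → Fin q}
    (htop : ∀ j, (top j : ℕ) = q - 1)
    (φ : bigThetaPiece k n q (((n : ℤ) + 1) * ((q : ℤ) - 1) - i) →ₗ[k] k) :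
    ∃ x ∈ bigThetaPiece k n q i, ∀ y : bigThetaPiece k n q (((n : ℤ) + 1) * ((q : ℤ) - 1) - i),
      bigThetaEquiv k n q (x * (y : BigTheta k n q)) top = φ y := by
  let p : bigThetaPiece k n q i →ₗ[k]
      Module.Dual k (bigThetaPiece k n q (((n : ℤ) + 1) * ((q : ℤ) - 1) - i)) :=
    ((LinearMap.mul k (BigTheta k n q)).compr₂
      (LinearMap.proj top ∘ₗ (bigThetaEquiv k n q).toLinearMap)).domRestrict₁₂ _ _
  have hp : Function.Injective p := by
    rw [← LinearMap.ker_eq_bot, LinearMap.ker_eq_bot']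
    intro x hx
    by_contra h0
    obtain ⟨y, hy, hxy⟩ := exists_mul_coeff_ne_zero htop x.2 fun h => h0 (Subtype.ext h)
    exact hxy (LinearMap.congr_fun hx ⟨y, hy⟩)
  -- Symmetry of the box count makes the dimensions agree, so the injection into the dual is onto.
  have hdim : Module.finrank k (bigThetaPiece k n q i) = Module.finrank k
      (Module.Dual k (bigThetaPiece k n q (((n : ℤ) + 1) * ((q : ℤ) - 1) - i))) := by
    rw [Subspace.dual_finrank_eq, finrank_bigThetaPiece, finrank_bigThetaPiece,
      ← boxCount_symm q (n + 1) i]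
    push_cast
    rfl
  obtain ⟨x, hx⟩ := (LinearMap.injective_iff_surjective_of_finrank_eq_finrank hdim).mp hp φ
  exact ⟨x, x.2, fun y => LinearMap.congr_fun hx y⟩

/-! ### Homogeneous components and homogeneity of the ideals. -/

variable (k n) in
/-- The projection of `S` onto its component of degree `i`, for an integer `i`. -/
def polyProj (i : ℤ) : Poly k n →ₗ[k] Poly k n :=
  if 0 ≤ i then homogeneousComponent i.toNat else 0

theorem coeff_polyProj (i : ℤ) (g : Poly k n) (e : Fin (n + 1) →₀ ℕ) :
    coeff e (polyProj k n i g) = if (e.degree : ℤ) = i then coeff e g else 0 := by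
  rcases lt_or_ge i 0 with hi | hi
  · rw [polyProj, if_neg (not_le.mpr hi), if_neg (by omega)]
    simp
  · lift i to ℕ using hi
    rw [polyProj, if_pos (by positivity), Int.toNat_natCast, coeff_homogeneousComponent]
    simp only [Nat.cast_inj]

theorem polyProj_mem (i : ℤ) (g : Poly k n) : polyProj k n i g ∈ polyPiece k n i :=
  mem_polyPiece_iff.mpr fun e he => by rw [coeff_polyProj, if_neg he]

theorem polyProj_of_mem {i : ℤ} {g : Poly k n} (hg : g ∈ polyPiece k n i) (j : ℤ) :
    polyProj k n j g = if i = j then g else 0 := by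
  ext e
  rw [coeff_polyProj]
  by_cases he : (e.degree : ℤ) = i
  · subst he
    split_ifs <;> simp
  · rw [mem_polyPiece_iff.mp hg e he]
    split_ifs <;> simp [mem_polyPiece_iff.mp hg e he]

theorem polyProj_mul {d : ℤ} {f : Poly k n} (hf : f ∈ polyPiece k n d) (i : ℤ) (a : Poly k n) :
    polyProj k n i (a * f) = polyProj k n (i - d) a * f := by
  induction a using MvPolynomial.induction_on' with
  | monomial e c =>
    have he := monomial_mem_polyPiece (n := n) e c
    rw [polyProj_of_mem he, polyProj_of_mem (mul_mem_polyPiece he hf)]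
    by_cases h : (e.degree : ℤ) + d = i
    · rw [if_pos h, if_pos (by omega)]
    · rw [if_neg h, if_neg (by omega), zero_mul]
  | add a b ha hb => rw [add_mul, map_add, map_add, add_mul, ha, hb]

theorem polyProj_mem_powIdeal {g : Poly k n} (hg : g ∈ powIdeal k n q) (i : ℤ) :
    polyProj k n i g ∈ powIdeal k n q := by
  rw [mem_powIdeal_iff] at hg ⊢
  intro e he
  refine hg e ?_
  rw [mem_support_iff, coeff_polyProj] at he
  exact mem_support_iff.mpr fun h => he (by rw [h, ite_self])

theorem mem_formIdeal {f g : Poly k n} :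
    g ∈ formIdeal f q ↔ ∃ a, g - a * f ∈ powIdeal k n q := by
  rw [formIdeal, Submodule.mem_sup]
  constructor
  · rintro ⟨y, hy, z, hz, rfl⟩
    obtain ⟨a, rfl⟩ := Ideal.mem_span_singleton'.mp hy
    exact ⟨a, by simpa using hz⟩
  · rintro ⟨a, ha⟩
    exact ⟨a * f, Ideal.mem_span_singleton'.mpr ⟨a, rfl⟩, _, ha, by ring⟩

theorem polyProj_sub_mem_powIdeal {d : ℤ} {f g a : Poly k n} (hf : f ∈ polyPiece k n d)
    (h : g - a * f ∈ powIdeal k n q) (i : ℤ) :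
    polyProj k n i g - polyProj k n (i - d) a * f ∈ powIdeal k n q := by
  rw [← polyProj_mul hf, ← map_sub]
  exact polyProj_mem_powIdeal h i

theorem polyProj_mem_formIdeal {d : ℤ} {f g : Poly k n} (hf : f ∈ polyPiece k n d)
    (hg : g ∈ formIdeal f q) (i : ℤ) : polyProj k n i g ∈ formIdeal f q := by
  obtain ⟨a, ha⟩ := mem_formIdeal.mp hg
  exact mem_formIdeal.mpr ⟨_, polyProj_sub_mem_powIdeal hf ha i⟩

/-- The dimension of a graded quotient of finite length is the sum of those of its components. -/
theorem finrank_eq_sum_quotPiece {J : Ideal (Poly k n)} [Module.Finite k (Poly k n ⧸ J)]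
    (hJ : ∀ g ∈ J, ∀ i, polyProj k n i g ∈ J) {M : ℕ}
    (hM : ∀ i : ℤ, M ≤ i → quotPiece J i = ⊥) :
    Module.finrank k (Poly k n ⧸ J) =
      ∑ i ∈ Finset.range M, Module.finrank k (quotPiece J i) := by
  let Ψ : (∀ i : Fin M, quotPiece J (i : ℕ)) →ₗ[k] Poly k n ⧸ J :=
    ∑ i : Fin M, (quotPiece J (i : ℕ)).subtype ∘ₗ LinearMap.proj i
  have hΨ : ∀ v, Ψ v = ∑ i : Fin M, (v i : Poly k n ⧸ J) := fun v => by simp [Ψ]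
  have hinj : Function.Injective Ψ := by
    rw [← LinearMap.ker_eq_bot, LinearMap.ker_eq_bot']
    intro v hv
    choose g hg hgv using fun i => mem_quotPiece.mp (v i).2
    rw [hΨ] at hv
    simp only [← hgv] at hv
    rw [← map_sum, Ideal.Quotient.eq_zero_iff_mem] at hv
    ext i
    -- The degree i component of the sum of the representatives is the i-th one alone, and it stays
    -- in J.
    have h := hJ _ hv (i : ℕ)
    rw [map_sum, Finset.sum_congr rfl fun j _ => polyProj_of_mem (hg j) _] at h
    simp only [Nat.cast_inj, Fin.val_inj] at h
    rw [Finset.sum_ite_eq' Finset.univ i g, if_pos (Finset.mem_univ i)] at h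
    rw [← hgv i]
    exact Ideal.Quotient.eq_zero_iff_mem.mpr h
  have hsurj : Function.Surjective Ψ := by
    intro x
    obtain ⟨g, rfl⟩ := Ideal.Quotient.mk_surjective x
    rw [← LinearMap.mem_range]
    induction g using MvPolynomial.induction_on' with
    | monomial e c =>
      have he := mk_mem_quotPiece J (monomial_mem_polyPiece e c)
      by_cases h : e.degree < M
      · refine ⟨Pi.single ⟨e.degree, h⟩ ⟨_, he⟩, ?_⟩
        rw [hΨ, Finset.sum_eq_single ⟨e.degree, h⟩]
        · rw [Pi.single_eq_same]
        · intro j _ hj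
          rw [Pi.single_eq_of_ne hj, ZeroMemClass.coe_zero]
        · simp
      · rw [hM _ (by exact_mod_cast not_lt.mp h), Submodule.mem_bot] at he
        rw [he]
        exact Submodule.zero_mem _
    | add a b ha hb =>
      rw [map_add]
      exact Submodule.add_mem _ ha hb
  rw [← (LinearEquiv.ofBijective Ψ ⟨hinj, hsurj⟩).finrank_eq, Module.finrank_pi_fintype,
    Finset.sum_range]

/-! ### θ and ϑ as cokernel and kernel of multiplication by f. -/

/-- The projection `Θ → θ`. -/
def thetaProj (f : Poly k n) (q : ℕ) : BigTheta k n q →ₗ[k] SmallTheta f q :=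
  (Ideal.Quotient.factorₐ k (le_sup_right : powIdeal k n q ≤ formIdeal f q)).toLinearMap

@[simp]
theorem thetaProj_mk (f g : Poly k n) :
    thetaProj f q (Ideal.Quotient.mk _ g) = Ideal.Quotient.mk _ g := rfl

theorem thetaProj_surjective (f : Poly k n) : Function.Surjective (thetaProj f q) := by
  intro x
  obtain ⟨g, rfl⟩ := Ideal.Quotient.mk_surjective x
  exact ⟨Ideal.Quotient.mk _ g, rfl⟩

instance (f : Poly k n) : Module.Finite k (SmallTheta f q) :=
  Module.Finite.of_surjective (thetaProj f q) (thetaProj_surjective f)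

theorem map_thetaProj_bigThetaPiece (f : Poly k n) (i : ℤ) :
    (bigThetaPiece k n q i).map (thetaProj f q) = smallThetaPiece f q i := by
  rw [bigThetaPiece, quotPiece, ← Submodule.map_comp]
  rfl

theorem thetaProj_mul (f : Poly k n) (x : BigTheta k n q) :
    thetaProj f q (Ideal.Quotient.mk (powIdeal k n q) f * x) = 0 := by
  obtain ⟨g, rfl⟩ := Ideal.Quotient.mk_surjective x
  rw [← map_mul, thetaProj_mk, Ideal.Quotient.eq_zero_iff_mem]
  exact mem_formIdeal.mpr ⟨g, by rw [mul_comm, sub_self]; exact Ideal.zero_mem _⟩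

/-- Graded exactness at Θ: a cofactor of f may be replaced by its component of degree i - d. -/
theorem exists_mul_eq_of_thetaProj_eq_zero {d : ℤ} {f : Poly k n} (hf : f ∈ polyPiece k n d)
    {i : ℤ} {x : BigTheta k n q} (hx : x ∈ bigThetaPiece k n q i) (h0 : thetaProj f q x = 0) :
    ∃ y ∈ bigThetaPiece k n q (i - d), Ideal.Quotient.mk (powIdeal k n q) f * y = x := by
  obtain ⟨g, hg, rfl⟩ := mem_quotPiece.mp hx
  rw [thetaProj_mk, Ideal.Quotient.eq_zero_iff_mem] at h0
  obtain ⟨a, ha⟩ := mem_formIdeal.mp h0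
  refine ⟨_, mk_mem_quotPiece _ (polyProj_mem (i - d) a), ?_⟩
  have h := polyProj_sub_mem_powIdeal hf ha i
  rw [polyProj_of_mem hg, if_pos rfl] at h
  rw [← map_mul, mul_comm, eq_comm, Ideal.Quotient.eq]
  exact h

theorem mul_mem_bigThetaPiece {d : ℤ} {f : Poly k n} (hf : f ∈ polyPiece k n d) {i : ℤ}
    {x : BigTheta k n q} (hx : x ∈ bigThetaPiece k n q (i - d)) :
    Ideal.Quotient.mk (powIdeal k n q) f * x ∈ bigThetaPiece k n q i := by
  have h := mul_mem_quotPiece (mk_mem_quotPiece (powIdeal k n q) hf) hx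
  rwa [add_sub_cancel] at h

/-- Rank-nullity for Θ_i → θ_i, whose kernel is f Θ_{i-d}. All dimension estimates below rest on it.
-/
theorem finrank_smallThetaPiece_add {d : ℤ} {f : Poly k n} (hf : f ∈ polyPiece k n d) (i : ℤ) :
    Module.finrank k (smallThetaPiece f q i) +
      Module.finrank k (LinearMap.range (mulRestrict f q (i - d))) =
        Module.finrank k (bigThetaPiece k n q i) := by
  have h := LinearMap.finrank_range_add_finrank_ker
    ((thetaProj f q).domRestrict (bigThetaPiece k n q i))
  rw [LinearMap.range_domRestrict, map_thetaProj_bigThetaPiece] at h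
  suffices e : LinearMap.range (mulRestrict f q (i - d)) = (LinearMap.ker
      ((thetaProj f q).domRestrict (bigThetaPiece k n q i))).map
        (bigThetaPiece k n q i).subtype by
    rw [← h, e, Submodule.finrank_map_subtype_eq]
  ext x
  simp only [LinearMap.mem_range, Submodule.mem_map, LinearMap.mem_ker, Subtype.exists]
  constructor
  · rintro ⟨y, hy, rfl⟩
    exact ⟨_, mul_mem_bigThetaPiece hf hy, thetaProj_mul f y, rfl⟩
  · rintro ⟨z, hz, hz0, rfl⟩
    obtain ⟨y, hy, hyz⟩ := exists_mul_eq_of_thetaProj_eq_zero hf hz hz0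
    exact ⟨y, hy, hyz⟩

theorem mem_varThetaPiece {f : Poly k n} {i : ℤ} {x : BigTheta k n q} :
    x ∈ varThetaPiece f q i ↔
      x ∈ bigThetaPiece k n q i ∧ Ideal.Quotient.mk (powIdeal k n q) f * x = 0 := by
  rw [varThetaPiece, Submodule.mem_inf, and_comm, Submodule.restrictScalars_mem, varTheta,
    Ideal.mem_map_iff_of_surjective _ Ideal.Quotient.mk_surjective]
  refine and_congr_right fun _ => ?_
  have hcolon : ∀ g : Poly k n, g ∈ (powIdeal k n q).colon {f} ↔
      Ideal.Quotient.mk (powIdeal k n q) f * Ideal.Quotient.mk (powIdeal k n q) g = 0 := by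
    intro g
    rw [Submodule.mem_colon_singleton, smul_eq_mul, mul_comm, ← map_mul,
      Ideal.Quotient.eq_zero_iff_mem]
  constructor
  · rintro ⟨g, hg, rfl⟩
    exact (hcolon g).mp hg
  · intro h
    obtain ⟨g, rfl⟩ := Ideal.Quotient.mk_surjective x
    exact ⟨g, (hcolon g).mpr h, rfl⟩

theorem finrank_range_mulRestrict_of_varThetaPiece_eq_bot {f : Poly k n} {j : ℤ}
    (h : varThetaPiece f q j = ⊥) :
    Module.finrank k (LinearMap.range (mulRestrict f q j)) =
      Module.finrank k (bigThetaPiece k n q j) := by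
  refine LinearMap.finrank_range_of_inj ?_
  rw [← LinearMap.ker_eq_bot, LinearMap.ker_eq_bot']
  intro x hx
  have : (x : BigTheta k n q) ∈ varThetaPiece f q j := mem_varThetaPiece.mpr ⟨x.2, hx⟩
  rw [h, Submodule.mem_bot] at this
  exact Subtype.ext this

/-- Since `Θ` is Gorenstein with socle in degree `N = (n + 1)(q - 1)`, the module `ϑ` is the
dual of `θ`, up to a shift by `N`; this is the resulting statement on their degrees. -/
theorem varThetaPiece_eq_bot_iff {d : ℤ} {f : Poly k n} (hf : f ∈ polyPiece k n d)
    (hq : 0 < q) (j : ℤ) : varThetaPiece f q j = ⊥ ↔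
      smallThetaPiece f q (((n : ℤ) + 1) * ((q : ℤ) - 1) - j) = ⊥ := by
  have htop : ∀ j : Fin (n + 1), (((fun _ => ⟨q - 1, by omega⟩ : Fin (n + 1) → Fin q) j : Fin q)
    : ℕ) = q - 1 := fun _ => rfl
  constructor
  · intro h
    by_contra hne
    have hlt : LinearMap.ker ((thetaProj f q).domRestrict
        (bigThetaPiece k n q (((n : ℤ) + 1) * ((q : ℤ) - 1) - j))) < ⊤ := by
      rw [lt_top_iff_ne_top, Ne, LinearMap.ker_eq_top, ← LinearMap.range_eq_bot,
        LinearMap.range_domRestrict, map_thetaProj_bigThetaPiece]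
      exact hne
    -- A nonzero form φ on Θ_{N-j} that kills f Θ_{N-j-d}. The element x of Θ_j representing it
    -- satisfies f x = 0, since f x pairs with y as φ(f y) = 0; so x lies in ϑ_j = 0, contradicting
    -- φ ≠ 0.
    obtain ⟨φ, hφ0, hφ⟩ := Submodule.exists_le_ker_of_lt_top _ hlt
    obtain ⟨x, hx, hxφ⟩ := exists_forall_coeff_mul_eq htop φ
    have hx0 : x = 0 := by
      rw [← Submodule.mem_bot k, ← h, mem_varThetaPiece]
      refine ⟨hx, ?_⟩
      by_contra hfx
      obtain ⟨y, hy, hy0⟩ := exists_mul_coeff_ne_zero htop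
        (mul_mem_bigThetaPiece hf (i := j + d) (by rwa [add_sub_cancel_right])) hfx
      rw [← sub_sub] at hy
      have hfy := hxφ ⟨_, mul_mem_bigThetaPiece hf hy⟩
      rw [LinearMap.mem_ker.mp (hφ (LinearMap.mem_ker.mpr (thetaProj_mul f y)))] at hfy
      refine hy0 ?_
      rw [← hfy, mul_comm _ x, mul_assoc]
    refine hφ0 (LinearMap.ext fun y => ?_)
    rw [← hxφ, hx0]
    simp
  · intro h
    rw [Submodule.eq_bot_iff]
    intro x hx
    rw [mem_varThetaPiece] at hx
    by_contra hx0
    obtain ⟨y, hy, hxy⟩ := exists_mul_coeff_ne_zero htop hx.1 hx0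
    have hy0 : thetaProj f q y = 0 := by
      rw [← Submodule.mem_bot k, ← h, ← map_thetaProj_bigThetaPiece]
      exact Submodule.mem_map_of_mem hy
    -- As θ_{N-j} = 0, the partner of x is f z, and x f z = 0 because f kills x.
    obtain ⟨z, -, rfl⟩ := exists_mul_eq_of_thetaProj_eq_zero hf hy hy0
    refine hxy ?_
    rw [← mul_assoc, mul_comm x, hx.2]
    simp

/-! ### The middle degree m(q), the bounds and the equivalences. -/

theorem bigThetaPiece_eq_bot_iff (i : ℤ) :
    bigThetaPiece k n q i = ⊥ ↔ boxCount q (n + 1) i = 0 := by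
  rw [← finrank_bigThetaPiece (k := k), Submodule.finrank_eq_zero]

theorem bigThetaPiece_eq_bot {i : ℤ} (hi : i < 0 ∨ ((n : ℤ) + 1) * ((q : ℤ) - 1) < i) :
    bigThetaPiece k n q i = ⊥ := by
  rw [bigThetaPiece_eq_bot_iff]
  rcases hi with hi | hi
  · exact boxCount_of_neg q _ hi
  · exact boxCount_of_gt q _ (by exact_mod_cast hi)

theorem smallThetaPiece_eq_bot {f : Poly k n} {i : ℤ} (h : bigThetaPiece k n q i = ⊥) :
    smallThetaPiece f q i = ⊥ := by
  rw [← map_thetaProj_bigThetaPiece, h, Submodule.map_bot]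

theorem finrank_range_mulRestrict_le {d : ℤ} {f : Poly k n} (i : ℤ) :
    Module.finrank k (LinearMap.range (mulRestrict f q (i - d))) ≤ boxCount q (n + 1) (i - d) := by
  rw [← finrank_bigThetaPiece (k := k)]
  exact LinearMap.finrank_range_le _

/-- The floor in m(q) is chosen so that i ≤ m(q) means (i - d) + i < N. -/
theorem boxCount_sub_lt {d : ℕ} (hn : 0 < n) (hq : 0 < q) (hd : 0 < d) {i : ℤ} (h0 : 0 ≤ i)
    (hi : i ≤ midDegree n d q) (hiN : i ≤ ((n : ℤ) + 1) * ((q : ℤ) - 1)) :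
    boxCount q (n + 1) (i - d) < boxCount q (n + 1) i := by
  unfold midDegree at hi
  refine boxCount_lt hq (by omega) (by omega) h0 ?_ ?_ <;> push_cast <;> omega

/-- Here 2i ≥ N + d, so the reflected points N - i and N - i + d have sum at most N. -/
theorem boxCount_le_sub {d : ℕ} (hn : 0 < n) (hq : 0 < q) {i : ℤ} (hi : midDegree n d q < i) :
    boxCount q (n + 1) i ≤ boxCount q (n + 1) (i - d) := by
  unfold midDegree at hi
  rw [← boxCount_symm q _ i, ← boxCount_symm q _ (i - d)]
  refine boxCount_le hq (by omega) (by omega) ?_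
  push_cast
  omega

/-- In degree m(q) the source of f is strictly smaller than the target, so f is not onto. The bound
d ≤ N keeps m(q) inside [0, N]. -/
theorem midDegree_mem_smallThetaDegrees {d : ℕ} (hn : 0 < n) (hq : 0 < q) (hd : 0 < d)
    (hdq : (d : ℤ) ≤ ((n : ℤ) + 1) * ((q : ℤ) - 1)) {f : Poly k n}
    (hf : f ∈ polyPiece k n d) : midDegree n d q ∈ smallThetaDegrees f q := by
  intro h
  have h1 := finrank_smallThetaPiece_add (q := q) hf (midDegree n d q)
  have h2 := finrank_range_mulRestrict_le (q := q) (d := d) (f := f) (midDegree n d q)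
  have h3 := boxCount_sub_lt (i := midDegree n d q) hn hq hd (by unfold midDegree; omega) le_rfl
    (by unfold midDegree; omega)
  rw [h, finrank_bot, finrank_bigThetaPiece] at h1
  omega

theorem isGreatest_socleDegree {f : Poly k n} (h : (smallThetaDegrees f q).Nonempty) :
    IsGreatest (smallThetaDegrees f q) (socleDegree f q) := by
  have hb : BddAbove (smallThetaDegrees f q) := by
    refine ⟨((n : ℤ) + 1) * ((q : ℤ) - 1), fun i hi => ?_⟩
    by_contra hlt
    exact hi (smallThetaPiece_eq_bot (bigThetaPiece_eq_bot (Or.inr (not_le.mp hlt))))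
  exact ⟨Int.csSup_mem h hb, fun i hi => le_csSup hb hi⟩

theorem isLeast_sub_socleDegree {d : ℤ} {f : Poly k n} (hf : f ∈ polyPiece k n d) (hq : 0 < q)
    (h : (smallThetaDegrees f q).Nonempty) : IsLeast (varThetaDegrees f q)
      (((n : ℤ) + 1) * ((q : ℤ) - 1) - socleDegree f q) := by
  have hmem : ∀ i, i ∈ varThetaDegrees f q ↔
      ((n : ℤ) + 1) * ((q : ℤ) - 1) - i ∈ smallThetaDegrees f q := fun i =>
    not_congr (varThetaPiece_eq_bot_iff hf hq i)
  have hg := isGreatest_socleDegree h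
  refine ⟨(hmem _).mpr (by rw [sub_sub_cancel]; exact hg.1), fun i hi => ?_⟩
  have := hg.2 ((hmem i).mp hi)
  linarith

theorem hilbertKunz_eq_sum {d : ℤ} {f : Poly k n} (hf : f ∈ polyPiece k n d) {N : ℕ}
    (hN : ((n : ℤ) + 1) * ((q : ℤ) - 1) = N) : hilbertKunz f q =
      ∑ i ∈ Finset.range (N + 1), Module.finrank k (smallThetaPiece f q i) :=
  finrank_eq_sum_quotPiece (fun _ hg i => polyProj_mem_formIdeal hf hg i) fun i hi =>
    smallThetaPiece_eq_bot (bigThetaPiece_eq_bot (Or.inr (by push_cast at hi; omega)))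

/-- Outside [0, N] the summand is max(-dim Θ_{i-d}, 0) = 0. -/
theorem lowerBound_eq_sum (d : ℕ) {N : ℕ} (hN : ((n : ℤ) + 1) * ((q : ℤ) - 1) = N) :
    lowerBound k n d q = ∑ i ∈ Finset.range (N + 1),
      max ((boxCount q (n + 1) i : ℤ) - boxCount q (n + 1) (i - d)) 0 := by
  rw [lowerBound]
  simp only [finrank_bigThetaPiece]
  rw [finsum_eq_sum_of_support_subset (s := (Finset.range (N + 1)).map Nat.castEmbedding),
    Finset.sum_map]
  · rfl
  · intro i hi
    by_contra h
    have h0 : boxCount q (n + 1) i = 0 := by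
      rw [← bigThetaPiece_eq_bot_iff (k := k)]
      refine bigThetaPiece_eq_bot ?_
      by_contra! h'
      obtain ⟨j, rfl⟩ := Int.eq_ofNat_of_zero_le h'.1
      refine h (Finset.mem_coe.mpr (Finset.mem_map.mpr ⟨j, Finset.mem_range.mpr ?_, rfl⟩))
      have := h'.2
      omega
    refine hi ?_
    simp [h0]

theorem isMaximalRank_iff {d : ℕ} {f : Poly k n} : IsMaximalRank f d q ↔
    ∀ i : ℤ, Module.finrank k (LinearMap.range (mulRestrict f q (i - d))) =
      min (boxCount q (n + 1) (i - d)) (boxCount q (n + 1) i) := by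
  simp only [IsMaximalRank, finrank_bigThetaPiece]

theorem isMaximalRank_iff_socleDegree {d : ℕ} (hn : 0 < n) (hq : 0 < q) (hd : 0 < d)
    (hdq : (d : ℤ) ≤ ((n : ℤ) + 1) * ((q : ℤ) - 1)) {f : Poly k n}
    (hf : f ∈ polyPiece k n d) :
    IsMaximalRank f d q ↔ socleDegree f q = midDegree n d q := by
  have hm := midDegree_mem_smallThetaDegrees hn hq hd hdq hf
  have hg := isGreatest_socleDegree ⟨_, hm⟩
  have hdim := finrank_smallThetaPiece_add (q := q) hf
  simp only [finrank_bigThetaPiece] at hdim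
  rw [isMaximalRank_iff]
  constructor
  · intro h
    refine le_antisymm ?_ (hg.2 hm)
    by_contra! hlt
    refine hg.1 (Submodule.finrank_eq_zero.mp ?_)
    have h1 := hdim (socleDegree f q)
    rw [h, min_eq_right (boxCount_le_sub hn hq hlt)] at h1
    omega
  · intro h i
    have hzero : ∀ j, midDegree n d q < j → smallThetaPiece f q j = ⊥ := fun j hj => by
      by_contra hne
      have := hg.2 hne
      omega
    rcases lt_or_ge (midDegree n d q) i with hi | hi
    · have h1 := hdim i
      rw [hzero i hi, finrank_bot, zero_add] at h1
      rw [h1, min_eq_right (boxCount_le_sub hn hq hi)]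
    · have hv : varThetaPiece f q (i - d) = ⊥ := by
        rw [varThetaPiece_eq_bot_iff hf hq]
        -- From i ≤ m(q) and 2 m(q) < N + d follows N - (i - d) > m(q), so vanishing of θ above m(q)
        -- dualizes to injectivity of f on Θ_{i-d}.
        refine hzero _ ?_
        unfold midDegree at hi ⊢
        omega
      have h1 := finrank_range_mulRestrict_of_varThetaPiece_eq_bot hv
      have h2 := hdim i
      rw [finrank_bigThetaPiece] at h1
      omega

theorem max_sub_le_finrank_smallThetaPiece {d : ℕ} {f : Poly k n} (hf : f ∈ polyPiece k n d)
    (i : ℤ) : max ((boxCount q (n + 1) i : ℤ) - boxCount q (n + 1) (i - d)) 0 ≤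
      Module.finrank k (smallThetaPiece f q i) := by
  have h1 := finrank_smallThetaPiece_add (q := q) hf i
  have h2 := finrank_range_mulRestrict_le (q := q) (d := d) (f := f) i
  rw [finrank_bigThetaPiece] at h1
  omega

/-- The inequality of sums holds termwise, so equality is termwise; and dim Θ_i - rank = max(dim Θ_i
- dim Θ_{i-d}, 0) says exactly that the rank is the minimum. Where Θ_i = 0 both rank and minimum
vanish. -/
theorem isMaximalRank_iff_hilbertKunz {d : ℕ} {f : Poly k n} (hf : f ∈ polyPiece k n d) {N : ℕ}
    (hN : ((n : ℤ) + 1) * ((q : ℤ) - 1) = N) :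
    IsMaximalRank f d q ↔ (hilbertKunz f q : ℤ) = lowerBound k n d q := by
  have hdim := finrank_smallThetaPiece_add (q := q) hf
  simp only [finrank_bigThetaPiece] at hdim
  rw [isMaximalRank_iff, hilbertKunz_eq_sum hf hN, lowerBound_eq_sum d hN, Nat.cast_sum, eq_comm,
    Finset.sum_eq_sum_iff_of_le fun (i : ℕ) _ =>
      max_sub_le_finrank_smallThetaPiece (q := q) hf (i : ℤ)]
  constructor
  · intro h i _
    have h1 := hdim i
    have h2 := h i
    omega
  · intro h i
    have h1 := hdim i
    by_cases hi : bigThetaPiece k n q i = ⊥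
    · rw [bigThetaPiece_eq_bot_iff] at hi
      omega
    · have hi' : 0 ≤ i ∧ i ≤ ((n : ℤ) + 1) * ((q : ℤ) - 1) := by
        by_contra h'
        exact hi (bigThetaPiece_eq_bot (by omega))
      obtain ⟨j, rfl⟩ := Int.eq_ofNat_of_zero_le hi'.1
      have h2 := h j (Finset.mem_range.mpr (by have := hi'.2; omega))
      omega

end HilbertKunz

end

theorem theorem2 {k : Type*} [Field k] (n d q : ℕ) (hn : 0 < n) (hd : 0 < d)
    (hdq : (d : ℤ) ≤ ((n : ℤ) + 1) * ((q : ℤ) - 1))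
    (f : MvPolynomial (Fin (n + 1)) k) (hf : f.IsHomogeneous d) :
    -- the dimension, the maximum, the minimum and the sum in the definitions are genuine
    Module.Finite k (HilbertKunz.SmallTheta f q) ∧
    IsGreatest (HilbertKunz.smallThetaDegrees f q) (HilbertKunz.socleDegree f q) ∧
    IsLeast (HilbertKunz.varThetaDegrees f q) (HilbertKunz.initialDegree f q) ∧
    {i : ℤ | HilbertKunz.bigThetaPiece k n q i ≠ ⊥}.Finite ∧
    -- the bounds
    HilbertKunz.midDegree n d q ≤ HilbertKunz.socleDegree f q ∧
    HilbertKunz.initialDegree f q ≤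
      ((n : ℤ) + 1) * ((q : ℤ) - 1) - HilbertKunz.midDegree n d q ∧
    HilbertKunz.lowerBound k n d q ≤ (HilbertKunz.hilbertKunz f q : ℤ) ∧
    -- the equivalences
    List.TFAE [
      HilbertKunz.IsMaximalRank f d q,
      HilbertKunz.socleDegree f q = HilbertKunz.midDegree n d q,
      HilbertKunz.initialDegree f q =
        ((n : ℤ) + 1) * ((q : ℤ) - 1) - HilbertKunz.midDegree n d q,
      (HilbertKunz.hilbertKunz f q : ℤ) = HilbertKunz.lowerBound k n d q] := by
  have hd' : (0 : ℤ) < d := by exact_mod_cast hd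
  have hq : 0 < q := by
    by_contra h
    rw [show q = 0 by omega] at hdq
    push_cast at hdq
    linarith
  have hfd : f ∈ HilbertKunz.polyPiece k n d := hf
  obtain ⟨N, hN⟩ := Int.eq_ofNat_of_zero_le (hd'.le.trans hdq)
  have hm := HilbertKunz.midDegree_mem_smallThetaDegrees hn hq hd hdq hfd
  have hg := HilbertKunz.isGreatest_socleDegree ⟨_, hm⟩
  have hl := HilbertKunz.isLeast_sub_socleDegree hfd hq ⟨_, hm⟩
  have hi : HilbertKunz.initialDegree f q = _ := hl.csInf_eq
  have hle := hg.2 hm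
  refine ⟨inferInstance, hg, hi ▸ hl, ?_, hle, by rw [hi]; linarith, ?_, ?_⟩
  · refine (Set.finite_Icc 0 (((n : ℤ) + 1) * ((q : ℤ) - 1))).subset fun i hi => ?_
    by_contra h
    rw [Set.mem_Icc] at h
    exact hi (HilbertKunz.bigThetaPiece_eq_bot (by omega))
  · rw [HilbertKunz.hilbertKunz_eq_sum hfd hN, HilbertKunz.lowerBound_eq_sum d hN, Nat.cast_sum]
    exact Finset.sum_le_sum fun i _ => HilbertKunz.max_sub_le_finrank_smallThetaPiece hfd i
  · tfae_have 1 ↔ 2 := HilbertKunz.isMaximalRank_iff_socleDegree hn hq hd hdq hfd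
    tfae_have 2 ↔ 3 := by
      rw [hi]
      exact ⟨fun h => by rw [h], fun h => by linarith⟩
    tfae_have 1 ↔ 4 := HilbertKunz.isMaximalRank_iff_hilbertKunz hfd hN
    tfae_finish
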